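/- Let $n\ge 0$ and let $\tilde L\subset\mathbb R\times\mathbb R^n$ be a lattice such that the projection $\pi_1:\mathbb R\times\mathbb R^n\to\mathbb R$ is injective on $\tilde L$ and $\pi_2(\tilde L)$ is dense in $\mathbb R^n$, where $\pi_2$ is the projection to $\mathbb R^n$. Put $L=\pi_1(\tilde L)$, and for $z\in L$ let $z^*\in\mathbb R^n$ be the unique point with $(z,z^*)\in\tilde L$. Let $\Omega\subset\mathbb R^n$ be compact with $\Omega=\overline{\operatorname{int}\Omega}\neq\varnothing$, let $\partial\Omega$ have Lebesgue measure $0$, and let $L^*\cap\partial\Omega=\varnothing$, where $L^*=\{z^*\mid z\in L\}$. Let $\Lambda=\{z\in L\mid z^*\in\Omega\}$ (a generic, regular model set in one dimension). Then: 1. The points of $\Lambda$ can be enumerated as a strictly increasing bi-infinite sequence $(p_k)_{k\in\mathbb Z}$. 2. There are only finitely many distinct distances between consecutive points of $\Lambda$. 3. Let $(p_k)_{k\in\mathbb Z}$ be any strictly increasing enumeration of $\Lambda$, let $\mathcal A$ be a finite alphabet, and let $c$ be a map to $\mathcal A$ that assigns different letters to different distances between consecutive points of $\Lambda$. Then the bi-infinite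 sequence $x=x_\Lambda\in\mathcal A^{\mathbb Z}$, $x_k=c(p_{k+1}-p_k)$, is strictly ergodic with respect to the action of $\mathbb Z$ by powers of the shift $(Sx)_k=x_{k+1}$. That is, the orbit closure $X=\overline{\{S^mx\mid m\in\mathbb Z\}}$ in the product topology (with $\mathcal A$ discrete) is minimal (compact, shift-invariant, and the orbit of every $y\in X$ is dense in $X$), and there is exactly one shift-invariant Borel probability measure on $X$. Moreover, $X$ equals the set of all $y\in\mathcal A^{\mathbb Z}$ that have exactly the same finite substrings as $x$ (the local indistinguishability class of $x$). -/

import Mathlib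

open Set MeasureTheory

/-- A cut and project scheme with physical space `ℝ` and internal space `ℝⁿ`: a lattice
(discrete subgroup spanning the whole space) in `ℝ × ℝⁿ` on which the first projection is
injective and whose image under the second projection is dense. -/
structure CutProjectScheme (n : ℕ) where
  lattice : Submodule ℤ (ℝ × EuclideanSpace ℝ (Fin n))
  [discrete : DiscreteTopology lattice]
  [isLattice : IsZLattice ℝ lattice]
  injOn_fst : Set.InjOn Prod.fst (lattice : Set (ℝ × EuclideanSpace ℝ (Fin n)))
  dense_snd : Dense (Prod.snd '' (lattice : Set (ℝ × EuclideanSpace ℝ (Fin n))))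

namespace CutProjectScheme

variable {n : ℕ} (C : CutProjectScheme n)

/-- The projection `L` of the lattice to the physical space. -/
def physical : Set ℝ := Prod.fst '' (C.lattice : Set (ℝ × EuclideanSpace ℝ (Fin n)))

/-- The star map `L → ℝⁿ`: the second projection of the (unique) lattice point above `z`. -/
noncomputable def starMap (z : C.physical) : EuclideanSpace ℝ (Fin n) :=
  (Classical.choose z.2).2

theorem starMap_eq {z : C.physical} {y : EuclideanSpace ℝ (Fin n)}
    (h : ((z : ℝ), y) ∈ C.lattice) : C.starMap z = y := by
  have hs := Classical.choose_spec z.2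
  have := C.injOn_fst hs.1 h hs.2
  exact congrArg Prod.snd this

/-- The set `Λ(Ω) = {z ∈ L | z* ∈ Ω}`. -/
def modelSet (Ω : Set (EuclideanSpace ℝ (Fin n))) : Set ℝ :=
  {z | ∃ h : z ∈ C.physical, C.starMap ⟨z, h⟩ ∈ Ω}

/-- `Ω` is a window: it is compact and the closure of its non-empty interior. -/
structure IsWindow (Ω : Set (EuclideanSpace ℝ (Fin n))) : Prop where
  isCompact : IsCompact Ω
  eq_closure_interior : Ω = closure (interior Ω)
  nonempty : Ω.Nonempty

/-- Regularity: the boundary of the window has Lebesgue measure zero. -/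
def IsRegularWindow (Ω : Set (EuclideanSpace ℝ (Fin n))) : Prop :=
  volume (frontier Ω) = 0

/-- Genericity: no point of `L*` lies on the boundary of the window. -/
def IsGenericWindow (Ω : Set (EuclideanSpace ℝ (Fin n))) : Prop :=
  Set.range C.starMap ∩ frontier Ω = ∅

end CutProjectScheme

/-- The set of distances between consecutive points of a set of reals. -/
def consecutiveGaps (Λ : Set ℝ) : Set ℝ :=
  {t | ∃ a ∈ Λ, ∃ b ∈ Λ, a < b ∧ Λ ∩ Set.Ioo a b = ∅ ∧ t = b - a}

namespace BiInfinite

variable {A : Type*}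

/-- The action of `m : ℤ` on bi-infinite sequences, i.e. the `m`-th power of the shift. -/
def shift (m : ℤ) (x : ℤ → A) : ℤ → A := fun k => x (k + m)

/-- The shift orbit of a sequence. -/
def orbit (x : ℤ → A) : Set (ℤ → A) := Set.range fun m : ℤ => shift m x

/-- The finite word `w` is a substring of `x`. -/
def OccursIn (w : List A) (x : ℤ → A) : Prop :=
  ∃ j : ℤ, ∀ i : Fin w.length, x (j + (i : ℕ)) = w.get i

/-- The class of all sequences locally indistinguishable from `x`. -/
def LIClass (x : ℤ → A) : Set (ℤ → A) :=
  {y | ∀ w : List A, OccursIn w x ↔ OccursIn w y}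

/-- The orbit closure in the product topology. -/
def orbitClosure [TopologicalSpace A] (x : ℤ → A) : Set (ℤ → A) := closure (orbit x)

/-- `X` is a (non-empty) compact shift-invariant set all of whose orbits are dense in it. -/
structure IsMinimal [TopologicalSpace A] (X : Set (ℤ → A)) : Prop where
  isCompact : IsCompact X
  nonempty : X.Nonempty
  shift_mem : ∀ m : ℤ, ∀ y ∈ X, shift m y ∈ X
  orbitClosure_eq : ∀ y ∈ X, orbitClosure y = X

/-- There is exactly one shift-invariant probability measure on `X`; measures on `X` are
represented as measures on the full sequence space that give full mass to `X`. -/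
def IsUniquelyErgodic [MeasurableSpace A] (X : Set (ℤ → A)) : Prop :=
  ∃! μ : Measure (ℤ → A),
    IsProbabilityMeasure μ ∧ μ X = 1 ∧ ∀ m : ℤ, μ.map (shift m) = μ

/-- A sequence is strictly ergodic if its orbit closure is minimal and uniquely ergodic. -/
def IsStrictlyErgodic [TopologicalSpace A] [MeasurableSpace A] (x : ℤ → A) : Prop :=
  IsMinimal (orbitClosure x) ∧ IsUniquelyErgodic (orbitClosure x)

end BiInfinite

/-!
The model set is locally finite because a bounded part of a strip `ℝ × Ω` contains finitely many
lattice points, and relatively dense because every strip `ℝ × U` with `U` open and non-empty meets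
the lattice with bounded gaps (`CutProjectScheme.exists_lattice_mem_strip`). This gives the
enumeration and, since gaps are first coordinates of lattice points in a bounded set, their
finiteness.

For the dynamics, write `q k` for the star image of `p k`. Whether a finite pattern occurs in the
coding sequence at position `k` depends only on which of finitely many translates of `Ω` contain
`q k`. So the occurrences of a pattern are the `k` with `q k ∈ W`, where `W` is a Boolean
combination of such translates; its boundary is again a null set that avoids `L*`
(`CutProjectScheme.IsVisible`). Two facts follow.

* If a pattern occurs at all, then `W ∩ Ω` has an interior point, and the statement on strips makes
  the pattern recur with bounded gaps. Uniform recurrence gives minimality of the orbit closure and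
  its equality with the local indistinguishability class.
* Each pattern has a frequency, uniformly in the position of the counting interval, because lattice
  points are uniformly distributed in strips over bounded sets with null boundary
  (`CutProjectScheme.exists_uniform_density`). No harmonic analysis is needed for this: any two
  boxes `v + [0, T) × W` can be matched by a lattice translation up to a bounded overhang and a slight
  enlargement of `W`, and the mean of the counts over a fundamental domain is the volume of the box
  divided by the covolume.

An invariant probability measure on the orbit closure must give each cylinder the frequency of its
pattern, so there is at most one; a weak limit of empirical measures along the orbit is one.
-/

/-! ### Symbolic dynamics: orbit closures and invariant measures from cylinder statistics -/

namespace BiInfinite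

variable {A : Type*}

/-- The cylinder of all sequences that agree with `a` on the finite set `I` of coordinates. -/
def cylinder (I : Finset ℤ) (a : ℤ → A) : Set (ℤ → A) := {y | ∀ i ∈ I, y i = a i}

/-- The times at which the shift orbit of `x` visits `Z`. -/
def visits (x : ℤ → A) (Z : Set (ℤ → A)) : Set ℤ := {k | shift k x ∈ Z}

/-- A set of integers has bounded gaps. -/
def IsSyndetic (K : Set ℤ) : Prop := ∃ M : ℕ, ∀ m : ℤ, ∃ i : ℕ, i ≤ M ∧ m + i ∈ K

/-- The number of elements of `K` in the interval `[m, m + N)`. -/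
noncomputable def visitCount (K : Set ℤ) (m : ℤ) (N : ℕ) : ℝ :=
  ∑ i ∈ Finset.range N, K.indicator (fun _ => (1 : ℝ)) (m + i)

/-- `K` has density `f`, uniformly over all intervals of a given length. The error bound
`ε * N + C` is equivalent to the usual `o(N)` and needs no lower bound on `N`. -/
def HasUniformFrequency (K : Set ℤ) (f : ℝ) : Prop :=
  ∀ ε > 0, ∃ C : ℝ, ∀ (m : ℤ) (N : ℕ), |visitCount K m N - f * N| ≤ ε * N + C

theorem shift_apply (m : ℤ) (x : ℤ → A) (k : ℤ) : shift m x k = x (k + m) := rfl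

theorem shift_shift (m k : ℤ) (x : ℤ → A) : shift m (shift k x) = shift (m + k) x := by
  ext i; simp only [shift_apply, add_assoc]

theorem IsSyndetic.translate {K : Set ℤ} (h : IsSyndetic K) (j : ℤ) :
    IsSyndetic {k | k + j ∈ K} := by
  obtain ⟨M, hM⟩ := h
  refine ⟨M, fun m => ?_⟩
  obtain ⟨i, hi, hK⟩ := hM (m + j)
  exact ⟨i, hi, by simpa only [mem_ofPred_eq, add_right_comm] using hK⟩

theorem indicator_one_congr {α β : Type*} {s : Set α} {t : Set β} {a : α} {b : β}
    (h : a ∈ s ↔ b ∈ t) :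
    s.indicator (fun _ => (1 : ℝ)) a = t.indicator (fun _ => (1 : ℝ)) b := by
  by_cases hb : b ∈ t
  · rw [indicator_of_mem hb, indicator_of_mem (h.2 hb)]
  · rw [indicator_of_notMem hb, indicator_of_notMem (fun ha => hb (h.1 ha))]

theorem HasUniformFrequency.translate {K : Set ℤ} {f : ℝ} (h : HasUniformFrequency K f) (j : ℤ) :
    HasUniformFrequency {k | k + j ∈ K} f := by
  intro ε hε
  obtain ⟨C, hC⟩ := h ε hε
  refine ⟨C, fun m N => ?_⟩
  have : visitCount {k | k + j ∈ K} m N = visitCount K (m + j) N := by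
    refine Finset.sum_congr rfl fun i _ => ?_
    exact indicator_one_congr (by rw [mem_ofPred_eq, add_right_comm m j])
  rw [this]
  exact hC _ _

/-- A linear function bounded by `ε * N + C` for every `ε` has slope zero. -/
theorem eq_of_forall_mul_nat_le {a b : ℝ}
    (h : ∀ ε > 0, ∃ C : ℝ, ∀ N : ℕ, |a * N - b * N| ≤ ε * N + C) : a = b := by
  by_contra hab
  have hpos : 0 < |a - b| := abs_pos.2 (sub_ne_zero.2 hab)
  obtain ⟨C, hC⟩ := h (|a - b| / 2) (by positivity)
  obtain ⟨N, hN⟩ := exists_nat_gt (C / (|a - b| / 2))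
  have h1 := hC N
  rw [← sub_mul, abs_mul, Nat.abs_cast] at h1
  rw [div_lt_iff₀ (by positivity)] at hN
  linarith

theorem isPiSystem_cylinder :
    IsPiSystem {Z : Set (ℤ → A) | ∃ I a, Z = cylinder I a} := by
  rintro _ ⟨I, a, rfl⟩ _ ⟨J, b, rfl⟩ ⟨z, hzI, hzJ⟩
  classical
  refine ⟨I ∪ J, z, ?_⟩
  ext y
  simp only [cylinder, mem_inter_iff, mem_ofPred_eq, Finset.mem_union]
  constructor
  · rintro ⟨h1, h2⟩ i (hi | hi)
    · rw [h1 i hi, hzI i hi]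
    · rw [h2 i hi, hzJ i hi]
  · intro h
    exact ⟨fun i hi => (h i (.inl hi)).trans (hzI i hi),
      fun i hi => (h i (.inr hi)).trans (hzJ i hi)⟩

theorem continuous_shift [TopologicalSpace A] (m : ℤ) : Continuous (shift m : (ℤ → A) → ℤ → A) :=
  continuous_pi fun _ => continuous_apply _

theorem self_mem_orbitClosure [TopologicalSpace A] (x : ℤ → A) : x ∈ orbitClosure x :=
  subset_closure ⟨0, by ext; simp [shift_apply]⟩

theorem measurable_shift [MeasurableSpace A] (m : ℤ) : Measurable (shift m : (ℤ → A) → ℤ → A) :=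
  measurable_pi_lambda _ fun _ => measurable_pi_apply _

section Topology

variable [TopologicalSpace A] [DiscreteTopology A]

theorem isClopen_cylinder (I : Finset ℤ) (a : ℤ → A) : IsClopen (cylinder I a) := by
  have : cylinder I a = ⋂ i ∈ I, (fun y : ℤ → A => y i) ⁻¹' {a i} := by
    ext y; simp [cylinder]
  rw [this]
  exact isClopen_biInter_finset fun i _ => (isClopen_discrete _).preimage (continuous_apply i)

theorem mem_orbitClosure_iff {x y : ℤ → A} :
    y ∈ orbitClosure x ↔ ∀ I : Finset ℤ, ∃ m : ℤ, ∀ i ∈ I, y i = x (i + m) := by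
  constructor
  · intro h I
    obtain ⟨z, hz, m, rfl⟩ := mem_closure_iff.1 h _ (isClopen_cylinder I y).isOpen
      (fun _ _ => rfl)
    exact ⟨m, fun i hi => (hz i hi).symm⟩
  · intro h
    refine mem_closure_iff.2 fun U hU hyU => ?_
    obtain ⟨I, u, hu, hIU⟩ := isOpen_pi_iff.1 hU y hyU
    obtain ⟨m, hm⟩ := h I
    refine ⟨shift m x, hIU fun i hi => ?_, m, rfl⟩
    rw [shift_apply, ← hm i hi]
    exact (hu i hi).2

theorem shift_mem_orbitClosure {x y : ℤ → A} (h : y ∈ orbitClosure x) (m : ℤ) :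
    shift m y ∈ orbitClosure x := by
  rw [mem_orbitClosure_iff] at h ⊢
  intro I
  obtain ⟨k, hk⟩ := h (I.image (· + m))
  exact ⟨m + k, fun i hi => by
    rw [shift_apply, hk _ (Finset.mem_image_of_mem _ hi), add_assoc]⟩

theorem orbitClosure_subset {x y : ℤ → A} (h : y ∈ orbitClosure x) :
    orbitClosure y ⊆ orbitClosure x :=
  closure_minimal (by rintro _ ⟨m, rfl⟩; exact shift_mem_orbitClosure h m) isClosed_closure

theorem OccursIn.of_mem_orbitClosure {x y : ℤ → A} (h : y ∈ orbitClosure x) {w : List A}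
    (hw : OccursIn w y) : OccursIn w x := by
  obtain ⟨j, hj⟩ := hw
  obtain ⟨m, hm⟩ := mem_orbitClosure_iff.1 h
    (Finset.univ.image fun i : Fin w.length => j + ((i : ℕ) : ℤ))
  refine ⟨j + m, fun i => ?_⟩
  rw [← hj i, hm _ (Finset.mem_image_of_mem _ (Finset.mem_univ i)), add_right_comm]

theorem mem_orbitClosure_of_occursIn {x y : ℤ → A} (h : ∀ w, OccursIn w y → OccursIn w x) :
    y ∈ orbitClosure x := by
  rw [mem_orbitClosure_iff]
  intro I
  obtain ⟨M, hM⟩ : ∃ M : ℕ, ∀ i ∈ I, |i| ≤ M := by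
    refine ⟨∑ i ∈ I, i.natAbs, fun i hi => ?_⟩
    rw [Int.abs_eq_natAbs]
    exact_mod_cast Finset.single_le_sum (f := Int.natAbs) (fun _ _ => Nat.zero_le _) hi
  -- the word of `y` on the window `[-M, M]`, which contains `I`
  obtain ⟨j, hj⟩ := h (List.ofFn fun i : Fin (2 * M + 1) => y (-M + (i : ℕ)))
    ⟨-M, fun i => by simp [-List.ofFn_succ]⟩
  refine ⟨j + M, fun i hi => ?_⟩
  have hi' := abs_le.1 (hM i hi)
  have hj' := hj ⟨(i + M).toNat, by rw [List.length_ofFn]; omega⟩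
  simp only [List.get_ofFn, Fin.val_cast, Int.toNat_of_nonneg (by omega : 0 ≤ i + M)] at hj'
  rw [show i + (j + M) = j + (i + M) by ring, hj']
  congr 1
  ring

/-- Uniform recurrence: if every pattern of `x` recurs with bounded gaps, then it occurs in every
element of the orbit closure, so the relation of lying in the orbit closure is symmetric. -/
theorem self_mem_orbitClosure_of_syndetic {x y : ℤ → A}
    (hx : ∀ I : Finset ℤ, IsSyndetic (visits x (cylinder I x))) (h : y ∈ orbitClosure x) :
    x ∈ orbitClosure y := by
  rw [mem_orbitClosure_iff] at h ⊢
  intro I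
  obtain ⟨M, hM⟩ := hx I
  obtain ⟨m, hm⟩ := h ((Finset.range (M + 1)).biUnion fun i => I.image (· + (i : ℤ)))
  obtain ⟨i, hi, hmi⟩ := hM m
  refine ⟨i, fun t ht => ?_⟩
  rw [hm (t + i) (Finset.mem_biUnion.2
    ⟨i, Finset.mem_range.2 (by omega), Finset.mem_image_of_mem _ ht⟩)]
  have := hmi t ht
  rw [shift_apply] at this
  rw [← this]
  congr 1
  ring

theorem liClass_eq_orbitClosure {x : ℤ → A}
    (hx : ∀ I : Finset ℤ, IsSyndetic (visits x (cylinder I x))) :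
    LIClass x = orbitClosure x := by
  ext y
  refine ⟨fun h => mem_orbitClosure_of_occursIn fun w => (h w).2, fun h w => ⟨?_, ?_⟩⟩
  · exact OccursIn.of_mem_orbitClosure (self_mem_orbitClosure_of_syndetic hx h)
  · exact OccursIn.of_mem_orbitClosure h

/-- Finite stretches of an orbit in the orbit closure of `x` are stretches of the orbit of `x`. -/
theorem exists_sum_indicator_cylinder_eq_visitCount {x y : ℤ → A} (hy : y ∈ orbitClosure x)
    (I : Finset ℤ) (a : ℤ → A) (N : ℕ) :
    ∃ m, ∑ i ∈ Finset.range N, (cylinder I a).indicator (fun _ => (1 : ℝ)) (shift (i : ℤ) y) =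
      visitCount (visits x (cylinder I a)) m N := by
  obtain ⟨m, hm⟩ := mem_orbitClosure_iff.1 hy
    ((Finset.range N).biUnion fun i => I.image (· + (i : ℤ)))
  refine ⟨m, Finset.sum_congr rfl fun i hi => ?_⟩
  have : shift (i : ℤ) y ∈ cylinder I a ↔ m + i ∈ visits x (cylinder I a) := by
    refine forall₂_congr fun t ht => ?_
    rw [shift_apply, shift_apply, hm (t + i) (Finset.mem_biUnion.2
      ⟨i, hi, Finset.mem_image_of_mem _ ht⟩), add_assoc, add_comm m]
  exact indicator_one_congr this

theorem isMinimal_orbitClosure [Finite A] {x : ℤ → A}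
    (hx : ∀ I : Finset ℤ, IsSyndetic (visits x (cylinder I x))) :
    IsMinimal (orbitClosure x) where
  isCompact := isClosed_closure.isCompact
  nonempty := ⟨x, self_mem_orbitClosure x⟩
  shift_mem m _ hy := shift_mem_orbitClosure hy m
  orbitClosure_eq _ hy := (orbitClosure_subset hy).antisymm
    (orbitClosure_subset (self_mem_orbitClosure_of_syndetic hx hy))

end Topology

section Measure

variable [Finite A] [TopologicalSpace A] [DiscreteTopology A]
  [MeasurableSpace A] [DiscreteMeasurableSpace A]

theorem measurableSet_cylinder (I : Finset ℤ) (a : ℤ → A) : MeasurableSet (cylinder I a) :=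
  (isClopen_cylinder I a).isOpen.measurableSet

theorem generateFrom_cylinder :
    (MeasurableSpace.pi : MeasurableSpace (ℤ → A)) =
      MeasurableSpace.generateFrom {Z : Set (ℤ → A) | ∃ I a, Z = cylinder I a} := by
  apply le_antisymm
  · refine iSup_le fun i => ?_
    rintro _ ⟨s, -, rfl⟩
    have : (fun y : ℤ → A => y i) ⁻¹' s = ⋃ b ∈ s, cylinder {i} fun _ => b := by
      ext y; simp [cylinder]
    rw [this]
    exact MeasurableSet.biUnion (s.to_countable) fun b _ =>
      MeasurableSpace.measurableSet_generateFrom ⟨_, _, rfl⟩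
  · refine MeasurableSpace.generateFrom_le ?_
    rintro _ ⟨I, a, rfl⟩
    exact measurableSet_cylinder I a

theorem measure_ext_of_cylinder {μ ν : Measure (ℤ → A)} [IsProbabilityMeasure μ]
    [IsProbabilityMeasure ν] (h : ∀ I a, μ (cylinder I a) = ν (cylinder I a)) : μ = ν :=
  ext_of_generate_finite _ generateFrom_cylinder isPiSystem_cylinder
    (by rintro _ ⟨I, a, rfl⟩; exact h I a) (by simp)

theorem measureReal_cylinder_eq {x : ℤ → A} {μ : Measure (ℤ → A)} [IsProbabilityMeasure μ]
    (hX : μ (orbitClosure x) = 1) (hinv : ∀ m : ℤ, μ.map (shift m) = μ)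
    {I : Finset ℤ} {a : ℤ → A} {f : ℝ}
    (hf : HasUniformFrequency (visits x (cylinder I a)) f) : μ.real (cylinder I a) = f := by
  refine eq_of_forall_mul_nat_le fun ε hε => ?_
  obtain ⟨C, hC⟩ := hf ε hε
  refine ⟨C, fun N => ?_⟩
  have hXm : MeasurableSet (orbitClosure x) := isClosed_closure.measurableSet
  have hae : ∀ᵐ y ∂μ, y ∈ orbitClosure x := by
    rw [← prob_compl_eq_zero_iff hXm] at hX
    exact hX
  have hZ := measurableSet_cylinder I a
  have hmeas : ∀ i : ℕ, MeasurableSet (shift (i : ℤ) ⁻¹' cylinder I a) :=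
    fun i => measurable_shift _ hZ
  have hfun : ∀ i : ℕ, (fun y : ℤ → A => (cylinder I a).indicator (fun _ => (1 : ℝ))
      (shift (i : ℤ) y)) = (shift (i : ℤ) ⁻¹' cylinder I a).indicator (fun _ => (1 : ℝ)) :=
    fun i => rfl
  have hint : ∀ i ∈ Finset.range N, Integrable (fun y : ℤ → A =>
      (cylinder I a).indicator (fun _ => (1 : ℝ)) (shift (i : ℤ) y)) μ := by
    intro i _
    rw [hfun]
    exact (integrable_const _).indicator (hmeas i)
  have hsum : ∫ y, ∑ i ∈ Finset.range N,
      (cylinder I a).indicator (fun _ => (1 : ℝ)) (shift (i : ℤ) y) ∂μ =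
      μ.real (cylinder I a) * N := by
    rw [integral_finsetSum _ hint]
    have : ∀ i ∈ Finset.range N, ∫ y, (cylinder I a).indicator (fun _ => (1 : ℝ))
        (shift (i : ℤ) y) ∂μ = μ.real (cylinder I a) := by
      intro i _
      rw [hfun, integral_indicator_const _ (hmeas i), smul_eq_mul, mul_one, measureReal_def,
        ← Measure.map_apply (measurable_shift _) hZ, hinv, measureReal_def]
    rw [Finset.sum_congr rfl this, Finset.sum_const, Finset.card_range, nsmul_eq_mul, mul_comm]
  have hconst : ∫ _ : ℤ → A, f * N ∂μ = f * N := by simp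
  rw [← hsum, ← hconst, ← integral_sub (integrable_finsetSum _ hint) (integrable_const _)]
  have := norm_integral_le_of_norm_le_const (μ := μ) (C := ε * N + C)
    (f := fun y => ∑ i ∈ Finset.range N,
      (cylinder I a).indicator (fun _ => (1 : ℝ)) (shift (i : ℤ) y) - f * N) (by
      filter_upwards [hae] with y hy
      obtain ⟨m, hm⟩ := exists_sum_indicator_cylinder_eq_visitCount hy I a N
      rw [hm]
      exact hC m N)
  simpa using this

open Filter Topology in
/-- A weak limit of the empirical measures along the orbit of `x` is an invariant measure. -/
theorem exists_invariant_measure {x : ℤ → A}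
    (hf : ∀ I a, ∃ f, HasUniformFrequency (visits x (cylinder I a)) f) :
    ∃ μ : Measure (ℤ → A),
      IsProbabilityMeasure μ ∧ μ (orbitClosure x) = 1 ∧ ∀ m : ℤ, μ.map (shift m) = μ := by
  -- the empirical measures of `N + 1` points, which avoids the division by zero at `N = 0`
  let E : ℕ → Measure (ℤ → A) := fun N =>
    ((N + 1 : ℕ) : ENNReal)⁻¹ • ∑ i ∈ Finset.range (N + 1), Measure.dirac (shift (i : ℤ) x)
  have hEX : ∀ N (X : Set (ℤ → A)), (∀ m, shift m x ∈ X) → E N X = 1 := by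
    intro N X hX
    have : ∀ i ∈ Finset.range (N + 1), Measure.dirac (shift (i : ℤ) x) X = 1 :=
      fun i _ => Measure.dirac_apply_of_mem (hX i)
    simp only [E, Measure.smul_apply, Measure.finsetSum_apply, smul_eq_mul]
    rw [Finset.sum_congr rfl this, Finset.sum_const, Finset.card_range, nsmul_eq_mul, mul_one]
    exact ENNReal.inv_mul_cancel (by simp) (ENNReal.natCast_ne_top _)
  have hEp : ∀ N, IsProbabilityMeasure (E N) := fun N => ⟨hEX N univ fun _ => mem_univ _⟩
  let P : ℕ → ProbabilityMeasure (ℤ → A) := fun N => ⟨E N, hEp N⟩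
  let U : Ultrafilter ℕ := Ultrafilter.of atTop
  have hU : (U : Filter ℕ) ≤ atTop := Ultrafilter.of_le atTop
  obtain ⟨μ, hμ⟩ : ∃ μ, Tendsto P U (𝓝 μ) := ⟨(U.map P).lim, (U.map P).le_nhds_lim⟩
  -- Cylinders are clopen, so their empirical measures converge, to the frequency of the pattern;
  -- since frequencies are uniform, shifting the cylinder does not change the limit.
  have hcyl : ∀ I a m f, HasUniformFrequency (visits x (cylinder I a)) f →
      (μ : Measure (ℤ → A)) (shift m ⁻¹' cylinder I a) = ENNReal.ofReal f := by
    intro I a m f hf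
    have hclopen : IsClopen (shift m ⁻¹' cylinder I a) :=
      (isClopen_cylinder I a).preimage (continuous_shift m)
    have h1 : Tendsto (fun N => (P N : Measure (ℤ → A)) (shift m ⁻¹' cylinder I a)) U
        (𝓝 ((μ : Measure (ℤ → A)) (shift m ⁻¹' cylinder I a))) :=
      ProbabilityMeasure.tendsto_measure_of_null_frontier_of_tendsto' hμ
        (by rw [hclopen.frontier_eq, measure_empty])
    refine tendsto_nhds_unique h1 (Tendsto.mono_left ?_ hU)
    have h2 : ∀ N, (P N : Measure (ℤ → A)) (shift m ⁻¹' cylinder I a) =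
        ENNReal.ofReal (visitCount (visits x (cylinder I a)) m (N + 1) / (N + 1 : ℕ)) := by
      intro N
      have hpos : (0 : ℝ) < (N + 1 : ℕ) := by positivity
      change E N _ = _
      rw [ENNReal.ofReal_div_of_pos hpos, visitCount,
        ENNReal.ofReal_sum_of_nonneg fun i _ => indicator_nonneg (fun _ _ => zero_le_one) _,
        ENNReal.ofReal_natCast, ENNReal.div_eq_inv_mul]
      simp only [E, Measure.smul_apply, Measure.finsetSum_apply, smul_eq_mul]
      congr 1
      refine Finset.sum_congr rfl fun i _ => ?_
      rw [Measure.dirac_apply' _ hclopen.isOpen.measurableSet]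
      have : shift (i : ℤ) x ∈ shift m ⁻¹' cylinder I a ↔ m + i ∈ visits x (cylinder I a) := by
        rw [mem_preimage, shift_shift]; rfl
      by_cases hi : m + i ∈ visits x (cylinder I a)
      · rw [indicator_of_mem hi, indicator_of_mem (this.2 hi)]; simp
      · rw [indicator_of_notMem hi, indicator_of_notMem (fun h => hi (this.1 h))]; simp
    simp only [h2]
    refine ENNReal.tendsto_ofReal ?_
    rw [Metric.tendsto_atTop]
    intro ε hε
    obtain ⟨C, hC⟩ := hf (ε / 2) (by positivity)
    obtain ⟨N₀, hN₀⟩ := exists_nat_gt (C / (ε / 2))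
    refine ⟨N₀, fun N hN => ?_⟩
    have hpos : (0 : ℝ) < (N + 1 : ℕ) := by positivity
    have hN' : (N₀ : ℝ) ≤ (N + 1 : ℕ) := by exact_mod_cast hN.trans (Nat.le_succ N)
    rw [div_lt_iff₀ (by positivity)] at hN₀
    rw [Real.dist_eq, div_sub' hpos.ne', abs_div, abs_of_pos hpos, div_lt_iff₀ hpos, mul_comm _ f]
    have := hC m (N + 1)
    nlinarith
  refine ⟨μ, inferInstance, le_antisymm prob_le_one ?_, fun m => ?_⟩
  · have := ProbabilityMeasure.limsup_measure_closed_le_of_tendsto hμ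
      (isClosed_closure : IsClosed (orbitClosure x))
    refine le_trans (le_of_eq ?_) this
    have h1 : ∀ N, (P N : Measure (ℤ → A)) (orbitClosure x) = 1 :=
      fun N => hEX N _ fun m => subset_closure ⟨m, rfl⟩
    exact ((congrArg (fun u => limsup u (U : Filter ℕ)) (funext h1)).trans (limsup_const _)).symm
  · have : IsProbabilityMeasure ((μ : Measure (ℤ → A)).map (shift m)) :=
      Measure.isProbabilityMeasure_map (measurable_shift m).aemeasurable
    refine measure_ext_of_cylinder fun I a => ?_
    obtain ⟨f, hf⟩ := hf I a
    have h0 : shift 0 ⁻¹' cylinder I a = cylinder I a := by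
      ext y; simp [cylinder, shift_apply]
    rw [Measure.map_apply (measurable_shift m) (measurableSet_cylinder I a), hcyl I a m f hf,
      ← hcyl I a 0 f hf, h0]

theorem isUniquelyErgodic_orbitClosure {x : ℤ → A}
    (hf : ∀ I a, ∃ f, HasUniformFrequency (visits x (cylinder I a)) f) :
    IsUniquelyErgodic (orbitClosure x) := by
  obtain ⟨μ, hμp, hμX, hμ⟩ := exists_invariant_measure hf
  refine ⟨μ, ⟨hμp, hμX, hμ⟩, ?_⟩
  rintro ν ⟨hνp, hνX, hν⟩
  refine measure_ext_of_cylinder fun I a => ?_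
  obtain ⟨f, hf⟩ := hf I a
  rw [← measureReal_eq_measureReal_iff, measureReal_cylinder_eq hνX hν hf,
    measureReal_cylinder_eq hμX hμ hf]

end Measure

end BiInfinite

/-! ### Uniform distribution of lattice points in strips -/

namespace CutProjectScheme

variable {n : ℕ} (C : CutProjectScheme n)

attribute [instance] CutProjectScheme.discrete CutProjectScheme.isLattice

/-- The box `v + [0, T) × W` in `ℝ × ℝⁿ`. -/
def box (v : ℝ × EuclideanSpace ℝ (Fin n)) (T : ℝ) (W : Set (EuclideanSpace ℝ (Fin n))) :
    Set (ℝ × EuclideanSpace ℝ (Fin n)) :=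
  {l | v.1 ≤ l.1 ∧ l.1 < v.1 + T ∧ l.2 - v.2 ∈ W}

/-- The number of lattice points in a set. It is `0` for a set with infinitely many of them, but
only bounded sets are used. -/
noncomputable def latticeCount (S : Set (ℝ × EuclideanSpace ℝ (Fin n))) : ℕ :=
  ((C.lattice : Set (ℝ × EuclideanSpace ℝ (Fin n))) ∩ S).ncard

theorem isBounded_box (v : ℝ × EuclideanSpace ℝ (Fin n)) (T : ℝ)
    {W : Set (EuclideanSpace ℝ (Fin n))} (hW : Bornology.IsBounded W) :
    Bornology.IsBounded (box v T W) := by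
  obtain ⟨r, hr⟩ := hW.exists_norm_le
  refine (isBounded_iff_forall_norm_le (E := ℝ × EuclideanSpace ℝ (Fin n))).2
    ⟨‖v‖ + max |T| r, fun l hl => ?_⟩
  have h : ‖l - v‖ ≤ max |T| r := by
    refine max_le_max ?_ (hr _ hl.2.2)
    rw [Prod.fst_sub, Real.norm_eq_abs, abs_le]
    have := le_abs_self T
    constructor <;> linarith [hl.1, hl.2.1, abs_nonneg T]
  calc ‖l‖ = ‖v + (l - v)‖ := by rw [add_sub_cancel]
    _ ≤ _ := (norm_add_le _ _).trans (by gcongr)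

theorem finite_lattice_inter {S : Set (ℝ × EuclideanSpace ℝ (Fin n))}
    (hS : Bornology.IsBounded S) :
    ((C.lattice : Set (ℝ × EuclideanSpace ℝ (Fin n))) ∩ S).Finite := by
  have : DiscreteTopology C.lattice.toAddSubgroup := C.discrete
  have hc : IsClosed (C.lattice : Set (ℝ × EuclideanSpace ℝ (Fin n))) :=
    AddSubgroup.isClosed_of_discrete (H := C.lattice.toAddSubgroup)
  rw [inter_comm]
  exact Metric.finite_isBounded_inter_isClosed ⟨C.discrete⟩ hS hc

theorem latticeCount_union_le (S S' : Set (ℝ × EuclideanSpace ℝ (Fin n))) :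
    C.latticeCount (S ∪ S') ≤ C.latticeCount S + C.latticeCount S' := by
  rw [latticeCount, inter_union_distrib_left]
  exact ncard_union_le _ _

/-- Boxes of a fixed shape contain a bounded number of lattice points, wherever they are. -/
theorem exists_latticeCount_box_le (T : ℝ) {W : Set (EuclideanSpace ℝ (Fin n))}
    (hW : Bornology.IsBounded W) : ∃ c : ℕ, ∀ v, C.latticeCount (box v T W) ≤ c := by
  obtain ⟨r, hr⟩ := Metric.isBounded_iff.1 hW
  refine ⟨C.latticeCount (Metric.closedBall 0 (max |T| r)), fun v => ?_⟩
  rcases ((C.lattice : Set (ℝ × EuclideanSpace ℝ (Fin n))) ∩ box v T W).eq_empty_or_nonempty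
    with h | ⟨l₀, hl₀, hb₀⟩
  · rw [latticeCount, h, ncard_empty]; exact Nat.zero_le _
  · refine ncard_le_ncard_of_injOn (· - l₀) ?_ (fun a _ b _ hab => sub_left_injective hab)
      (C.finite_lattice_inter Metric.isBounded_closedBall)
    rintro l ⟨hl, hb⟩
    refine ⟨C.lattice.sub_mem hl hl₀, ?_⟩
    rw [mem_closedBall_zero_iff]
    refine max_le_max ?_ ?_
    · rw [Prod.fst_sub, Real.norm_eq_abs, abs_le]
      have := le_abs_self T
      constructor <;> linarith [hb.1, hb.2.1, hb₀.1, hb₀.2.1]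
    · have := hr hb.2.2 hb₀.2.2
      rwa [dist_eq_norm, sub_sub_sub_cancel_right] at this

theorem exists_reduction_bounded :
    ∃ r : ℝ, ∀ v : ℝ × EuclideanSpace ℝ (Fin n), ∃ l ∈ C.lattice, ‖v - l‖ ≤ r := by
  let b := (Module.Free.chooseBasis ℤ C.lattice).ofZLatticeBasis ℝ C.lattice
  refine ⟨∑ i, ‖b i‖, fun v => ⟨ZSpan.floor b v, ?_, ZSpan.norm_fract_le b v⟩⟩
  exact (Module.Basis.ofZLatticeBasis_span ℝ C.lattice (Module.Free.chooseBasis ℤ C.lattice)).le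
    (ZSpan.floor b v).2

/-- Every translate of a strip `ℝ × U` with `U` open and non-empty meets the lattice with bounded
gaps, uniformly over all translates: this is the density of the projection of the lattice to
`ℝⁿ` together with the compactness of a fundamental domain. -/
theorem exists_lattice_mem_strip {U : Set (EuclideanSpace ℝ (Fin n))} (hU : IsOpen U)
    (hne : U.Nonempty) : ∃ R : ℝ, 0 ≤ R ∧ ∀ v : ℝ × EuclideanSpace ℝ (Fin n),
      ∃ l ∈ C.lattice, |l.1 - v.1| ≤ R ∧ l.2 - v.2 ∈ U := by
  obtain ⟨r, hr⟩ := C.exists_reduction_bounded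
  have hcover : Metric.closedBall (0 : ℝ × EuclideanSpace ℝ (Fin n)) r ⊆
      ⋃ l : C.lattice, {v | (l : ℝ × EuclideanSpace ℝ (Fin n)).2 - v.2 ∈ U} := by
    intro v _
    obtain ⟨u, hu⟩ := hne
    obtain ⟨_, hz, l, hl, rfl⟩ := C.dense_snd.inter_open_nonempty {y | y - v.2 ∈ U}
      (hU.preimage (continuous_id.sub continuous_const))
      ⟨u + v.2, by simpa using hu⟩
    exact mem_iUnion.2 ⟨⟨l, hl⟩, hz⟩
  obtain ⟨t, ht⟩ := (isCompact_closedBall (0 : ℝ × EuclideanSpace ℝ (Fin n)) r).elim_finite_subcover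
    _ (fun l => hU.preimage (continuous_const.sub continuous_snd)) hcover
  refine ⟨|r| + ∑ l ∈ t, ‖(l : ℝ × EuclideanSpace ℝ (Fin n))‖,
    add_nonneg (abs_nonneg _) (Finset.sum_nonneg fun _ _ => norm_nonneg _), fun v => ?_⟩
  obtain ⟨l', hl', hv⟩ := hr v
  obtain ⟨l, hlt, hlU⟩ := mem_iUnion₂.1 (ht (mem_closedBall_zero_iff.2 hv))
  refine ⟨l' + l, C.lattice.add_mem hl' l.2, ?_, ?_⟩
  · have h1 : |(v - l').1| ≤ |r| := ((norm_fst_le (v - l')).trans hv).trans (le_abs_self r)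
    have h2 : |(l : ℝ × EuclideanSpace ℝ (Fin n)).1| ≤
        ∑ l ∈ t, ‖(l : ℝ × EuclideanSpace ℝ (Fin n))‖ := (norm_fst_le _).trans
      (Finset.single_le_sum (f := fun l : C.lattice => ‖(l : ℝ × EuclideanSpace ℝ (Fin n))‖)
        (fun _ _ => norm_nonneg _) hlt)
    have : (l' + (l : ℝ × EuclideanSpace ℝ (Fin n))).1 - v.1 =
        (l : ℝ × EuclideanSpace ℝ (Fin n)).1 - (v - l').1 := by
      simp only [Prod.fst_add, Prod.fst_sub]; ring
    rw [this, add_comm]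
    exact (abs_sub _ _).trans (add_le_add h2 h1)
  · have : (l' + (l : ℝ × EuclideanSpace ℝ (Fin n))).2 - v.2 =
        (l : ℝ × EuclideanSpace ℝ (Fin n)).2 - (v - l').2 := by
      simp only [Prod.snd_add, Prod.snd_sub]; abel
    rw [this]
    exact hlU

/-- Moving a box by a suitable lattice vector carries it, up to a bounded overhang in the physical
direction and a displacement smaller than `δ` in the internal one, onto any other box of the same
length. -/
theorem exists_latticeCount_box_le_add {A B : Set (EuclideanSpace ℝ (Fin n))}
    (hB : Bornology.IsBounded B) {δ : ℝ} (hδ : 0 < δ)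
    (hAB : ∀ a ∈ A, ∀ e, ‖e‖ < δ → a + e ∈ B) :
    ∃ c : ℕ, ∀ (T : ℝ) (_ : 0 ≤ T) (v v' : ℝ × EuclideanSpace ℝ (Fin n)),
      C.latticeCount (box v T A) ≤ C.latticeCount (box v' T B) + c := by
  obtain ⟨R, hR, hit⟩ := C.exists_lattice_mem_strip
    (Metric.isOpen_ball (x := (0 : EuclideanSpace ℝ (Fin n))) (ε := δ)) ⟨0, by simpa using hδ⟩
  obtain ⟨c, hc⟩ := C.exists_latticeCount_box_le R hB
  refine ⟨c + c, fun T hT v v' => ?_⟩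
  obtain ⟨k, hk, hk1, hk2⟩ := hit (v' - v)
  rw [mem_ball_zero_iff] at hk2
  rw [Prod.fst_sub, abs_le] at hk1
  -- the translated box sticks out of the target by at most `R` at either end
  let S := (box v' T B) ∪ (box (v'.1 - R, v'.2) R B ∪ box (v'.1 + T, v'.2) R B)
  have hS : Bornology.IsBounded S :=
    (isBounded_box _ _ hB).union ((isBounded_box _ _ hB).union (isBounded_box _ _ hB))
  have h1 : C.latticeCount (box v T A) ≤ C.latticeCount S := by
    refine ncard_le_ncard_of_injOn (· + k) ?_ (fun a _ b _ hab => add_left_injective _ hab)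
      (C.finite_lattice_inter hS)
    rintro l ⟨hl, hl1, hl2, hl3⟩
    refine ⟨C.lattice.add_mem hl hk, ?_⟩
    have h2 : (l + k).2 - v'.2 ∈ B := by
      have := hAB _ hl3 _ hk2
      convert this using 1
      simp only [Prod.snd_add, Prod.snd_sub]; abel
    have h3 : (l + k).1 = l.1 + k.1 := rfl
    rcases lt_or_ge (l + k).1 v'.1 with h | h
    · exact .inr (.inl ⟨by simp only; linarith, by simp only; linarith, h2⟩)
    rcases lt_or_ge (l + k).1 (v'.1 + T) with h' | h'
    · exact .inl ⟨h, h', h2⟩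
    · exact .inr (.inr ⟨h', by simp only; linarith, h2⟩)
  refine h1.trans ((C.latticeCount_union_le _ _).trans (Nat.add_le_add_left ?_ _))
  exact (C.latticeCount_union_le _ _).trans (add_le_add (hc _) (hc _))

/-- The number of lattice points in `box (-v) T W` as a sum over the lattice, the form in which it
unfolds over a fundamental domain. -/
theorem tsum_indicator_box (v : ℝ × EuclideanSpace ℝ (Fin n)) (T : ℝ)
    {W : Set (EuclideanSpace ℝ (Fin n))} (hW : Bornology.IsBounded W) :
    ∑' l : C.lattice, (box 0 T W).indicator (fun _ => (1 : ENNReal)) (l +ᵥ v) =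
      C.latticeCount (box (-v) T W) := by
  let F : Set C.lattice := {l | l +ᵥ v ∈ box 0 T W}
  have hF : (fun l : C.lattice => (l : ℝ × EuclideanSpace ℝ (Fin n))) '' F =
      (C.lattice : Set (ℝ × EuclideanSpace ℝ (Fin n))) ∩ box (-v) T W := by
    have key : ∀ l : C.lattice, l ∈ F ↔ (l : ℝ × EuclideanSpace ℝ (Fin n)) ∈ box (-v) T W := by
      intro l
      have h1 : (l +ᵥ v).1 = (l : ℝ × EuclideanSpace ℝ (Fin n)).1 + v.1 := rfl
      have h2 : (l +ᵥ v).2 = (l : ℝ × EuclideanSpace ℝ (Fin n)).2 + v.2 := rfl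
      simp only [F, box, mem_ofPred_eq, h1, h2, Prod.fst_zero, Prod.snd_zero, Prod.fst_neg,
        Prod.snd_neg, sub_zero, sub_neg_eq_add]
      refine and_congr ?_ (and_congr ?_ Iff.rfl) <;> constructor <;> intro h <;> linarith
    ext l
    constructor
    · rintro ⟨l, hl, rfl⟩
      exact ⟨l.2, (key l).1 hl⟩
    · rintro ⟨hl, hb⟩
      exact ⟨⟨l, hl⟩, (key ⟨l, hl⟩).2 hb, rfl⟩
  have hfin : F.Finite := Finite.of_finite_image
    (hF ▸ C.finite_lattice_inter (isBounded_box _ _ hW)) Subtype.val_injective.injOn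
  rw [latticeCount, ← hF, ncard_image_of_injective _ Subtype.val_injective]
  calc ∑' l : C.lattice, (box 0 T W).indicator (fun _ => (1 : ENNReal)) (l +ᵥ v)
      = ∑' l : C.lattice, F.indicator (fun _ => (1 : ENNReal)) l := rfl
    _ = ∑' _ : F, (1 : ENNReal) := (tsum_subtype F _).symm
    _ = (F.encard : ENNReal) := ENNReal.tsum_set_one F
    _ = F.ncard := by rw [← hfin.cast_ncard_eq]; rfl

theorem box_zero_eq_prod (T : ℝ) (W : Set (EuclideanSpace ℝ (Fin n))) :
    box 0 T W = Ico 0 T ×ˢ W := by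
  ext l; simp [box, and_assoc]

/-- The mean number of lattice points in a box, over all positions, is the volume of the box times
the constant `κ`, the inverse covolume of the lattice. Hence some position has at most that many
lattice points and some position has at least that many. -/
theorem exists_latticeCount_box_mean : ∃ κ : ℝ, 0 < κ ∧
    ∀ W : Set (EuclideanSpace ℝ (Fin n)), Bornology.IsBounded W → MeasurableSet W →
    ∀ T : ℝ, 0 ≤ T →
      (∃ v, (C.latticeCount (box v T W) : ℝ) ≤ κ * volume.real W * T) ∧
      (∃ v, κ * volume.real W * T ≤ C.latticeCount (box v T W)) := by
  have : (volume : Measure (ℝ × EuclideanSpace ℝ (Fin n))).IsAddHaarMeasure :=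
    inferInstanceAs ((volume.prod volume).IsAddHaarMeasure)
  have : VAddInvariantMeasure C.lattice (ℝ × EuclideanSpace ℝ (Fin n)) volume :=
    ⟨fun l s _ => measure_preimage_add volume (l : ℝ × EuclideanSpace ℝ (Fin n)) s⟩
  let b := Module.Free.chooseBasis ℤ C.lattice
  let D := ZSpan.fundamentalDomain (b.ofZLatticeBasis ℝ C.lattice)
  have hD : IsAddFundamentalDomain C.lattice D
      (volume : Measure (ℝ × EuclideanSpace ℝ (Fin n))) := ZLattice.isAddFundamentalDomain b volume
  have hD0 : volume D ≠ 0 := ZSpan.measure_fundamentalDomain_ne_zero _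
  have hDtop : volume D ≠ ⊤ := (ZSpan.fundamentalDomain_isBounded _).measure_lt_top.ne
  refine ⟨(volume.real D)⁻¹, inv_pos.2 (ENNReal.toReal_pos hD0 hDtop), fun W hW hWm T hT => ?_⟩
  let g : C.lattice → ℝ × EuclideanSpace ℝ (Fin n) → ENNReal := fun l v =>
    (box 0 T W).indicator (fun _ => (1 : ENNReal)) (l +ᵥ v)
  let f : ℝ × EuclideanSpace ℝ (Fin n) → ENNReal := fun v => ∑' l, g l v
  have hbox : MeasurableSet (box 0 T W) := by
    rw [box_zero_eq_prod]; exact measurableSet_Ico.prod hWm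
  have hg : ∀ l, Measurable (g l) := fun l =>
    (measurable_const.indicator hbox).comp (measurable_const_vadd l)
  have hfm : Measurable f := Measurable.tsum hg
  have hWtop : volume W ≠ ⊤ := hW.measure_lt_top.ne
  have hint : ∫⁻ v in D, f v = ENNReal.ofReal T * volume W := by
    rw [lintegral_tsum fun l => (hg l).aemeasurable, ← hD.lintegral_eq_tsum'',
      lintegral_indicator_const hbox, one_mul, box_zero_eq_prod, Measure.volume_eq_prod,
      Measure.prod_prod, Real.volume_Ico, sub_zero]
  have hmean : (⨍⁻ v in D, f v ∂volume).toReal = (volume.real D)⁻¹ * volume.real W * T := by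
    rw [setLAverage_eq, hint, ENNReal.toReal_div, ENNReal.toReal_mul, ENNReal.toReal_ofReal hT]
    simp only [measureReal_def]
    ring
  have hmean_top : ⨍⁻ v in D, f v ∂volume ≠ ⊤ := by
    rw [setLAverage_eq, hint]
    exact ENNReal.div_ne_top (ENNReal.mul_ne_top ENNReal.ofReal_ne_top hWtop) hD0
  have hf : ∀ v, f v = C.latticeCount (box (-v) T W) := fun v => C.tsum_indicator_box v T hW
  constructor
  · obtain ⟨v, -, hv⟩ := exists_le_setLAverage hD0 hDtop hfm.aemeasurable
    refine ⟨-v, ?_⟩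
    have h := ENNReal.toReal_mono hmean_top hv
    rw [hmean] at h
    refine le_trans (le_of_eq ?_) h
    exact ((congrArg ENNReal.toReal (hf v)).trans (ENNReal.toReal_natCast _)).symm
  · obtain ⟨v, -, hv⟩ := exists_setLAverage_le hD0 hD.nullMeasurableSet
      (f := f) (by rw [hint]; exact ENNReal.mul_ne_top ENNReal.ofReal_ne_top hWtop)
    refine ⟨-v, ?_⟩
    rw [hf v] at hv
    have h := ENNReal.toReal_mono (ENNReal.natCast_ne_top _) hv
    rwa [hmean, ENNReal.toReal_natCast] at h

/-- Lattice points are uniformly distributed in strips `ℝ × W` over bounded sets `W` with null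
boundary. The window is squeezed between slightly smaller and slightly larger compact sets; by
`exists_latticeCount_box_le_add` the count at one position is compared with that at a position where
it does not exceed (respectively reaches) its mean. -/
theorem exists_uniform_density : ∃ κ : ℝ, 0 < κ ∧
    ∀ W : Set (EuclideanSpace ℝ (Fin n)), Bornology.IsBounded W → volume (frontier W) = 0 →
    ∀ ε > 0, ∃ c : ℝ, ∀ (T : ℝ) (_ : 0 ≤ T) (v : ℝ × EuclideanSpace ℝ (Fin n)),
      |(C.latticeCount (box v T W) : ℝ) - κ * volume.real W * T| ≤ ε * T + c := by
  obtain ⟨κ, hκ, hmean⟩ := C.exists_latticeCount_box_mean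
  refine ⟨κ, hκ, fun W hW hfr ε hε => ?_⟩
  have hεκ : 0 < ε / κ := by positivity
  have hWtop : volume W ≠ ⊤ := hW.measure_lt_top.ne
  have hcl : volume (closure W) = volume W := measure_closure_of_null_frontier hfr
  have hin : volume (interior W) = volume W := measure_interior_of_null_frontier hfr
  have hε0 : ENNReal.ofReal (ε / κ) ≠ 0 := (ENNReal.ofReal_pos.2 hεκ).ne'
  -- the upper bound
  obtain ⟨c₁, hc₁⟩ : ∃ c : ℕ, ∀ (T : ℝ) (_ : 0 ≤ T) (v : ℝ × EuclideanSpace ℝ (Fin n)),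
      (C.latticeCount (box v T W) : ℝ) ≤ κ * (volume.real W + ε / κ) * T + c := by
    obtain ⟨U, hWU, hU, hUvol⟩ := (closure W).exists_isOpen_lt_add (μ := volume)
      (hcl ▸ hWtop) hε0
    rw [hcl] at hUvol
    obtain ⟨δ, hδ, hδU⟩ := hW.isCompact_closure.exists_cthickening_subset_open hU hWU
    have hBb : Bornology.IsBounded (Metric.cthickening δ (closure W)) :=
      hW.isCompact_closure.isBounded.cthickening
    obtain ⟨c, hc⟩ := C.exists_latticeCount_box_le_add (A := W) hBb hδ (fun a ha e he =>
      Metric.mem_cthickening_of_dist_le _ a _ _ (subset_closure ha) (by simpa using he.le))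
    refine ⟨c, fun T hT v => ?_⟩
    obtain ⟨v', hv'⟩ := (hmean _ hBb Metric.isClosed_cthickening.measurableSet T hT).1
    have h1 : (C.latticeCount (box v T W) : ℝ) ≤
        C.latticeCount (box v' T (Metric.cthickening δ (closure W))) + c := by
      exact_mod_cast hc T hT v v'
    have h2 : volume.real (Metric.cthickening δ (closure W)) ≤ volume.real W + ε / κ := by
      have := ENNReal.toReal_mono (ENNReal.add_ne_top.2 ⟨hWtop, ENNReal.ofReal_ne_top⟩)
        ((measure_mono hδU).trans hUvol.le)
      rwa [ENNReal.toReal_add hWtop ENNReal.ofReal_ne_top, ENNReal.toReal_ofReal hεκ.le] at this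
    calc _ ≤ _ := h1
      _ ≤ κ * volume.real (Metric.cthickening δ (closure W)) * T + c := by gcongr
      _ ≤ _ := by gcongr
  -- the lower bound
  obtain ⟨c₂, hc₂⟩ : ∃ c : ℕ, ∀ (T : ℝ) (_ : 0 ≤ T) (v : ℝ × EuclideanSpace ℝ (Fin n)),
      κ * (volume.real W - ε / κ) * T ≤ C.latticeCount (box v T W) + c := by
    obtain ⟨K, hKW, hK, hKvol⟩ := isOpen_interior.measurableSet.exists_isCompact_lt_add
      (μ := volume) (A := interior W) (hin ▸ hWtop) hε0
    rw [hin] at hKvol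
    obtain ⟨δ, hδ, hδU⟩ := hK.exists_cthickening_subset_open isOpen_interior hKW
    obtain ⟨c, hc⟩ := C.exists_latticeCount_box_le_add (A := K) hW hδ (fun a ha e he =>
      interior_subset (hδU (Metric.mem_cthickening_of_dist_le _ a _ _ ha (by simpa using he.le))))
    refine ⟨c, fun T hT v => ?_⟩
    obtain ⟨v', hv'⟩ := (hmean _ hK.isBounded hK.measurableSet T hT).2
    have h1 : (C.latticeCount (box v' T K) : ℝ) ≤ C.latticeCount (box v T W) + c := by
      exact_mod_cast hc T hT v' v
    have hKtop : volume K ≠ ⊤ := hK.measure_lt_top.ne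
    have h2 : volume.real W ≤ volume.real K + ε / κ := by
      have := ENNReal.toReal_mono (ENNReal.add_ne_top.2 ⟨hKtop, ENNReal.ofReal_ne_top⟩) hKvol.le
      rwa [ENNReal.toReal_add hKtop ENNReal.ofReal_ne_top, ENNReal.toReal_ofReal hεκ.le] at this
    calc _ ≤ κ * volume.real K * T := by gcongr; linarith
      _ ≤ _ := hv'
      _ ≤ _ := h1
  refine ⟨c₁ + c₂, fun T hT v => abs_le.2 ?_⟩
  have h1 := hc₁ T hT v
  have h2 := hc₂ T hT v
  have h3 : κ * (ε / κ) = ε := by field_simp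
  have e1 : κ * (volume.real W + ε / κ) * T = κ * volume.real W * T + ε * T := by
    rw [mul_add, h3, add_mul]
  have e2 : κ * (volume.real W - ε / κ) * T = κ * volume.real W * T - ε * T := by
    rw [mul_sub, h3, sub_mul]
  have p1 : (0 : ℝ) ≤ c₁ := c₁.cast_nonneg
  have p2 : (0 : ℝ) ≤ c₂ := c₂.cast_nonneg
  constructor <;> linarith

end CutProjectScheme

/-! ### Model sets on the line -/

/-- A locally finite set of reals that is unbounded in both directions is order isomorphic
to `ℤ`. -/
theorem exists_strictMono_range_eq {Λ : Set ℝ} (hfin : ∀ a b, (Λ ∩ Icc a b).Finite)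
    (hne : Λ.Nonempty) (hup : ∀ a, ∃ b ∈ Λ, a < b) (hdown : ∀ a, ∃ b ∈ Λ, b < a) :
    ∃ p : ℤ → ℝ, StrictMono p ∧ range p = Λ := by
  let _ : LocallyFiniteOrder Λ := LocallyFiniteOrder.ofFiniteIcc fun a b => by
    refine Finite.of_finite_image ((hfin a b).subset ?_) Subtype.val_injective.injOn
    rintro _ ⟨c, hc, rfl⟩
    exact ⟨c.2, hc⟩
  let _ : SuccOrder Λ := LinearLocallyFiniteOrder.succOrder Λ
  let _ : PredOrder Λ := LinearLocallyFiniteOrder.predOrder Λ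
  have : NoMaxOrder Λ := ⟨fun a => let ⟨b, hb, h⟩ := hup a; ⟨⟨b, hb⟩, h⟩⟩
  have : NoMinOrder Λ := ⟨fun a => let ⟨b, hb, h⟩ := hdown a; ⟨⟨b, hb⟩, h⟩⟩
  have : Nonempty Λ := hne.to_subtype
  let e : Λ ≃o ℤ := orderIsoIntOfLinearSuccPredArch
  refine ⟨fun k => e.symm k, fun _ _ h => e.symm.strictMono h, ?_⟩
  exact (e.symm.surjective.range_comp (Subtype.val : Λ → ℝ)).trans Subtype.range_val

theorem sub_mem_consecutiveGaps {Λ : Set ℝ} {p : ℤ → ℝ} (hp : StrictMono p) (hr : range p = Λ)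
    (k : ℤ) : p (k + 1) - p k ∈ consecutiveGaps Λ := by
  refine ⟨p k, hr ▸ mem_range_self k, p (k + 1), hr ▸ mem_range_self _, hp (lt_add_one k), ?_, rfl⟩
  rw [eq_empty_iff_forall_notMem]
  rintro z ⟨hz, h1, h2⟩
  rw [← hr] at hz
  obtain ⟨j, rfl⟩ := hz
  have := hp.lt_iff_lt.1 h1
  have := hp.lt_iff_lt.1 h2
  omega

theorem pos_of_mem_consecutiveGaps {Λ : Set ℝ} {g : ℝ} (hg : g ∈ consecutiveGaps Λ) : 0 < g := by
  obtain ⟨a, -, b, -, hab, -, rfl⟩ := hg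
  exact sub_pos.2 hab

namespace CutProjectScheme

variable {n : ℕ} {C : CutProjectScheme n} {Ω : Set (EuclideanSpace ℝ (Fin n))}

theorem mem_modelSet_iff_of_mem {z : ℝ} {y : EuclideanSpace ℝ (Fin n)} (h : (z, y) ∈ C.lattice) :
    z ∈ C.modelSet Ω ↔ y ∈ Ω := by
  have hz : z ∈ C.physical := ⟨_, h, rfl⟩
  have hs : C.starMap ⟨z, hz⟩ = y := C.starMap_eq h
  constructor
  · rintro ⟨_, h'⟩; rwa [hs] at h'
  · intro hy; exact ⟨hz, by rwa [hs]⟩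

theorem exists_of_mem_modelSet {z : ℝ} (hz : z ∈ C.modelSet Ω) : ∃ y ∈ Ω, (z, y) ∈ C.lattice := by
  obtain ⟨⟨l, hl, rfl⟩, -⟩ := id hz
  exact ⟨l.2, (mem_modelSet_iff_of_mem hl).1 hz, hl⟩

theorem snd_eq_of_fst_eq {l l' : ℝ × EuclideanSpace ℝ (Fin n)} (hl : l ∈ C.lattice)
    (hl' : l' ∈ C.lattice) (h : l.1 = l'.1) : l.2 = l'.2 :=
  congrArg Prod.snd (C.injOn_fst hl hl' h)

theorem IsWindow.interior_nonempty (hΩ : IsWindow Ω) : (interior Ω).Nonempty :=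
  closure_nonempty_iff.1 (hΩ.eq_closure_interior ▸ hΩ.nonempty)

theorem finite_modelSet_inter_Icc (hΩ : Bornology.IsBounded Ω) (a b : ℝ) :
    (C.modelSet Ω ∩ Icc a b).Finite := by
  refine ((C.finite_lattice_inter ((Metric.isBounded_Icc a b).prod hΩ)).image Prod.fst).subset ?_
  rintro z ⟨hz, hab⟩
  obtain ⟨y, hy, hl⟩ := exists_of_mem_modelSet hz
  exact ⟨(z, y), ⟨hl, hab, hy⟩, rfl⟩

theorem exists_mem_modelSet_near (hΩ : (interior Ω).Nonempty) :
    ∃ R : ℝ, 0 ≤ R ∧ ∀ t : ℝ, ∃ z ∈ C.modelSet Ω, |z - t| ≤ R := by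
  obtain ⟨R, hR, h⟩ := C.exists_lattice_mem_strip isOpen_interior hΩ
  refine ⟨R, hR, fun t => ?_⟩
  obtain ⟨l, hl, h1, h2⟩ := h (t, 0)
  rw [sub_zero] at h2
  exact ⟨l.1, (mem_modelSet_iff_of_mem hl).2 (interior_subset h2), h1⟩

theorem exists_enumeration (hΩ : IsWindow Ω) :
    ∃ p : ℤ → ℝ, StrictMono p ∧ range p = C.modelSet Ω := by
  obtain ⟨R, hR, h⟩ := exists_mem_modelSet_near (C := C) hΩ.interior_nonempty
  refine exists_strictMono_range_eq (finite_modelSet_inter_Icc hΩ.isCompact.isBounded) ?_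
    (fun a => ?_) (fun a => ?_)
  · obtain ⟨z, hz, -⟩ := h 0
    exact ⟨z, hz⟩
  · obtain ⟨z, hz, hd⟩ := h (a + R + 1)
    exact ⟨z, hz, by linarith [(abs_le.1 hd).1]⟩
  · obtain ⟨z, hz, hd⟩ := h (a - R - 1)
    exact ⟨z, hz, by linarith [(abs_le.1 hd).2]⟩

theorem exists_of_mem_consecutiveGaps {g : ℝ} (hg : g ∈ consecutiveGaps (C.modelSet Ω)) :
    ∃ y, (g, y) ∈ C.lattice ∧ ∃ u ∈ Ω, ∃ v ∈ Ω, y = u - v := by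
  obtain ⟨a, ha, b, hb, -, -, rfl⟩ := hg
  obtain ⟨v, hv, hlv⟩ := exists_of_mem_modelSet ha
  obtain ⟨u, hu, hlu⟩ := exists_of_mem_modelSet hb
  exact ⟨u - v, C.lattice.sub_mem hlu hlv, u, hu, v, hv, rfl⟩

/-- The gaps are bounded since the model set is relatively dense, and they are first coordinates of
lattice points whose second coordinate is a difference of two elements of the window. -/
theorem finite_consecutiveGaps (hΩ : IsWindow Ω) : (consecutiveGaps (C.modelSet Ω)).Finite := by
  obtain ⟨R, hR, h⟩ := exists_mem_modelSet_near (C := C) hΩ.interior_nonempty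
  obtain ⟨r, hr⟩ := Metric.isBounded_iff.1 hΩ.isCompact.isBounded
  refine ((C.finite_lattice_inter ((Metric.isBounded_Icc 0 (2 * R + 1)).prod
    (Metric.isBounded_closedBall (x := 0) (r := r)))).image Prod.fst).subset ?_
  intro g hg
  obtain ⟨y, hl, u, hu, v, hv, rfl⟩ := exists_of_mem_consecutiveGaps hg
  refine ⟨(g, u - v), ⟨hl, ⟨(pos_of_mem_consecutiveGaps hg).le, ?_⟩, ?_⟩, rfl⟩
  · obtain ⟨a, -, b, -, -, hemp, rfl⟩ := hg
    obtain ⟨z, hz, hd⟩ := h (a + R + 1)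
    rw [abs_le] at hd
    by_contra hlt
    simp only [not_le] at hlt
    exact (eq_empty_iff_forall_notMem.1 hemp z)
      ⟨hz, by linarith [hd.1], by linarith [hd.2]⟩
  · rw [mem_closedBall_zero_iff, ← dist_eq_norm]
    exact hr hu hv

/-! ### Sets of indices that are visible in internal space -/

/-- The boundary of `W` is a null set that contains no point of `L*`. -/
structure IsGenericRegular (C : CutProjectScheme n) (W : Set (EuclideanSpace ℝ (Fin n))) :
    Prop where
  volume_frontier : volume (frontier W) = 0
  notMem_frontier : ∀ l ∈ C.lattice, l.2 ∉ frontier W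

namespace IsGenericRegular

variable {W W' : Set (EuclideanSpace ℝ (Fin n))}

theorem univ : IsGenericRegular C univ := ⟨by simp, by simp⟩

theorem compl (h : IsGenericRegular C W) : IsGenericRegular C Wᶜ :=
  ⟨by rw [frontier_compl]; exact h.1, by rw [frontier_compl]; exact h.2⟩

theorem inter (h : IsGenericRegular C W) (h' : IsGenericRegular C W') :
    IsGenericRegular C (W ∩ W') := by
  have hsub : frontier (W ∩ W') ⊆ frontier W ∪ frontier W' :=
    (frontier_inter_subset W W').trans (union_subset_union inter_subset_left inter_subset_right)
  refine ⟨measure_mono_null hsub (measure_union_null h.1 h'.1), fun l hl hf => ?_⟩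
  exact (hsub hf).elim (h.2 l hl) (h'.2 l hl)

theorem preimage_add (h : IsGenericRegular C W) {l : ℝ × EuclideanSpace ℝ (Fin n)}
    (hl : l ∈ C.lattice) : IsGenericRegular C {y | y + l.2 ∈ W} := by
  have hf : frontier {y | y + l.2 ∈ W} = (· + l.2) ⁻¹' frontier W :=
    ((Homeomorph.addRight l.2).preimage_frontier W).symm
  refine ⟨?_, fun k hk => ?_⟩
  · rw [hf, measure_preimage_add_right]; exact h.1
  · rw [hf]; exact h.2 _ (C.lattice.add_mem hk hl)

theorem of_window (hreg : IsRegularWindow Ω) (hgen : C.IsGenericWindow Ω) :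
    IsGenericRegular C Ω := by
  refine ⟨hreg, fun l hl hf => ?_⟩
  exact eq_empty_iff_forall_notMem.1 hgen l.2 ⟨⟨⟨l.1, l, hl, rfl⟩, C.starMap_eq hl⟩, hf⟩

end IsGenericRegular

/-- `p` enumerates the model set increasingly, and `q k` is the star image of `p k`. -/
structure IsEnumeration (C : CutProjectScheme n) (Ω : Set (EuclideanSpace ℝ (Fin n)))
    (p : ℤ → ℝ) (q : ℤ → EuclideanSpace ℝ (Fin n)) : Prop where
  strictMono : StrictMono p
  range_eq : range p = C.modelSet Ω
  mem_lattice : ∀ k, (p k, q k) ∈ C.lattice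

/-- The set `K` of indices consists of the `k` with `q k ∈ W`, for some set `W` in internal space
whose boundary is null and avoids `L*`. -/
def IsVisible (C : CutProjectScheme n) (q : ℤ → EuclideanSpace ℝ (Fin n)) (K : Set ℤ) : Prop :=
  ∃ W, IsGenericRegular C W ∧ ∀ k, k ∈ K ↔ q k ∈ W

namespace IsVisible

variable {q : ℤ → EuclideanSpace ℝ (Fin n)} {K K' : Set ℤ}

theorem univ : IsVisible C q univ := ⟨_, .univ, fun _ => Iff.rfl⟩

theorem compl (h : IsVisible C q K) : IsVisible C q Kᶜ := by
  obtain ⟨W, hW, h⟩ := h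
  exact ⟨Wᶜ, hW.compl, fun k => not_congr (h k)⟩

theorem inter (h : IsVisible C q K) (h' : IsVisible C q K') : IsVisible C q (K ∩ K') := by
  obtain ⟨W, hW, h⟩ := h
  obtain ⟨W', hW', h'⟩ := h'
  exact ⟨W ∩ W', hW.inter hW', fun k => and_congr (h k) (h' k)⟩

theorem biInter {ι : Type*} {s : Set ι} (hs : s.Finite) {K : ι → Set ℤ}
    (h : ∀ i ∈ s, IsVisible C q (K i)) : IsVisible C q (⋂ i ∈ s, K i) := by
  induction s, hs using Set.Finite.induction_on with
  | empty => simpa using univ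
  | insert _ _ ih =>
    rw [biInter_insert]
    exact (h _ (mem_insert _ _)).inter (ih fun i hi => h i (mem_insert_of_mem _ hi))

theorem biUnion {ι : Type*} {s : Set ι} (hs : s.Finite) {K : ι → Set ℤ}
    (h : ∀ i ∈ s, IsVisible C q (K i)) : IsVisible C q (⋃ i ∈ s, K i) := by
  have := (biInter hs fun i hi => (h i hi).compl).compl
  simpa only [compl_iInter, compl_compl] using this

end IsVisible

namespace IsEnumeration

variable {p : ℤ → ℝ} {q : ℤ → EuclideanSpace ℝ (Fin n)}

theorem mem_window (h : IsEnumeration C Ω p q) (k : ℤ) : q k ∈ Ω :=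
  (mem_modelSet_iff_of_mem (h.mem_lattice k)).1 (h.range_eq ▸ mem_range_self k)

theorem exists_of_mem_lattice (h : IsEnumeration C Ω p q) {l : ℝ × EuclideanSpace ℝ (Fin n)}
    (hl : l ∈ C.lattice) (hΩ : l.2 ∈ Ω) : ∃ k, l = (p k, q k) := by
  have : l.1 ∈ range p := by rw [h.range_eq]; exact (mem_modelSet_iff_of_mem hl).2 hΩ
  obtain ⟨k, hk⟩ := this
  exact ⟨k, Prod.ext hk.symm (snd_eq_of_fst_eq hl (h.mem_lattice k) hk.symm)⟩

/-- A gap `g` follows `p k` if and only if `p k + g` is a point of the model set and no smaller gap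
has this property. -/
theorem gap_eq_iff (h : IsEnumeration C Ω p q) {g : ℝ}
    (hg : g ∈ consecutiveGaps (C.modelSet Ω)) (k : ℤ) :
    p (k + 1) - p k = g ↔ p k + g ∈ C.modelSet Ω ∧
      ∀ g' ∈ {g' ∈ consecutiveGaps (C.modelSet Ω) | g' < g}, p k + g' ∉ C.modelSet Ω := by
  rw [← h.range_eq]
  constructor
  · rintro rfl
    refine ⟨⟨k + 1, by ring⟩, ?_⟩
    rintro g' ⟨hg', hlt⟩ ⟨j, hj⟩
    have hpos := pos_of_mem_consecutiveGaps hg'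
    have h1 := h.strictMono.lt_iff_lt.1 (show p k < p j by linarith)
    have h2 := h.strictMono.lt_iff_lt.1 (show p j < p (k + 1) by linarith)
    omega
  · rintro ⟨⟨j, hj⟩, hmin⟩
    have hpos := pos_of_mem_consecutiveGaps hg
    have h1 := h.strictMono.lt_iff_lt.1 (show p k < p j by linarith)
    have h2 : p (k + 1) ≤ p j := h.strictMono.monotone (by omega)
    by_contra hne
    have h3 : p (k + 1) - p k < g := lt_of_le_of_ne (by linarith) hne
    exact hmin _ ⟨sub_mem_consecutiveGaps h.strictMono rfl k, h3⟩ ⟨k + 1, by ring⟩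

theorem isVisible_add_mem (h : IsEnumeration C Ω p q) (hΩ : IsGenericRegular C Ω) {g : ℝ}
    (hg : g ∈ consecutiveGaps (C.modelSet Ω)) : IsVisible C q {k | p k + g ∈ C.modelSet Ω} := by
  obtain ⟨y, hy, -⟩ := exists_of_mem_consecutiveGaps hg
  exact ⟨_, hΩ.preimage_add hy, fun k =>
    mem_modelSet_iff_of_mem (C.lattice.add_mem (h.mem_lattice k) hy)⟩

theorem isVisible_gap (h : IsEnumeration C Ω p q) (hΩ : IsGenericRegular C Ω)
    (hfin : (consecutiveGaps (C.modelSet Ω)).Finite) {g : ℝ}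
    (hg : g ∈ consecutiveGaps (C.modelSet Ω)) : IsVisible C q {k | p (k + 1) - p k = g} := by
  have : {k | p (k + 1) - p k = g} = {k | p k + g ∈ C.modelSet Ω} ∩
      ⋂ g' ∈ {g' ∈ consecutiveGaps (C.modelSet Ω) | g' < g}, {k | p k + g' ∈ C.modelSet Ω}ᶜ := by
    ext k
    rw [mem_ofPred_eq, h.gap_eq_iff hg, mem_inter_iff, mem_iInter₂]
    rfl
  rw [this]
  exact (h.isVisible_add_mem hΩ hg).inter (IsVisible.biInter (hfin.subset (sep_subset _ _))
    fun g' hg' => (h.isVisible_add_mem hΩ hg'.1).compl)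

theorem isVisible_add_one (h : IsEnumeration C Ω p q) (hΩ : IsGenericRegular C Ω)
    (hfin : (consecutiveGaps (C.modelSet Ω)).Finite) {K : Set ℤ} (hK : IsVisible C q K) :
    IsVisible C q {k | k + 1 ∈ K} := by
  obtain ⟨W, hW, hKW⟩ := hK
  have : {k | k + 1 ∈ K} = ⋃ g ∈ consecutiveGaps (C.modelSet Ω),
      {k | p (k + 1) - p k = g ∧ k + 1 ∈ K} := by
    ext k
    simp only [mem_iUnion₂, mem_ofPred_eq]
    exact ⟨fun hk => ⟨_, sub_mem_consecutiveGaps h.strictMono h.range_eq k, rfl, hk⟩,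
      fun ⟨_, _, _, hk⟩ => hk⟩
  rw [this]
  refine IsVisible.biUnion hfin fun g hg => ?_
  obtain ⟨y, hy, -⟩ := exists_of_mem_consecutiveGaps hg
  obtain ⟨V, hV, hgV⟩ := h.isVisible_gap hΩ hfin hg
  refine ⟨V ∩ {z | z + y ∈ W}, hV.inter (hW.preimage_add hy), fun k => ?_⟩
  rw [mem_inter_iff, ← hgV]
  refine and_congr_right fun hk => ?_
  have : q (k + 1) = q k + y := snd_eq_of_fst_eq (h.mem_lattice (k + 1))
    (C.lattice.add_mem (h.mem_lattice k) hy) (by simp only [Prod.fst_add]; linarith [hk])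
  rw [hKW, this]
  rfl

theorem isVisible_add_nat (h : IsEnumeration C Ω p q) (hΩ : IsGenericRegular C Ω)
    (hfin : (consecutiveGaps (C.modelSet Ω)).Finite) {K : Set ℤ} (hK : IsVisible C q K) (i : ℕ) :
    IsVisible C q {k | k + i ∈ K} := by
  induction i with
  | zero => simpa using hK
  | succ i ih =>
    have := h.isVisible_add_one hΩ hfin ih
    simpa only [mem_ofPred_eq, Nat.cast_succ, add_assoc, add_comm (1 : ℤ)] using this

theorem isVisible_letter (h : IsEnumeration C Ω p q) (hΩ : IsGenericRegular C Ω)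
    (hfin : (consecutiveGaps (C.modelSet Ω)).Finite) {A : Type*} (c : ℝ → A) (b : A) :
    IsVisible C q {k | c (p (k + 1) - p k) = b} := by
  have : {k | c (p (k + 1) - p k) = b} =
      ⋃ g ∈ {g ∈ consecutiveGaps (C.modelSet Ω) | c g = b}, {k | p (k + 1) - p k = g} := by
    ext k
    simp only [mem_iUnion₂, mem_ofPred_eq, exists_prop]
    exact ⟨fun hk => ⟨_, ⟨sub_mem_consecutiveGaps h.strictMono h.range_eq k, hk⟩, rfl⟩,
      fun ⟨_, ⟨_, hb⟩, hk⟩ => hk ▸ hb⟩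
  rw [this]
  exact IsVisible.biUnion (hfin.subset (sep_subset _ _)) fun g hg => h.isVisible_gap hΩ hfin hg.1

/-- The occurrences of a finite pattern in the coding sequence form a visible set, up to a shift
that makes all coordinates of the pattern non-negative. -/
theorem exists_isVisible_visits (h : IsEnumeration C Ω p q) (hΩ : IsGenericRegular C Ω)
    (hfin : (consecutiveGaps (C.modelSet Ω)).Finite) {A : Type*} (c : ℝ → A) (I : Finset ℤ)
    (a : ℤ → A) : ∃ (K : Set ℤ) (j : ℤ), IsVisible C q K ∧
      BiInfinite.visits (fun k => c (p (k + 1) - p k)) (BiInfinite.cylinder I a) =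
        {k | k + j ∈ K} := by
  obtain ⟨j, hj⟩ : ∃ j : ℤ, ∀ i ∈ I, j ≤ i := by
    obtain ⟨j, hj⟩ := I.bddBelow
    exact ⟨j, fun i hi => hj hi⟩
  refine ⟨⋂ i ∈ (I : Set ℤ), {k | k + (i - j).toNat ∈ {k | c (p (k + 1) - p k) = a i}}, j,
    IsVisible.biInter I.finite_toSet fun i _ =>
      h.isVisible_add_nat hΩ hfin (h.isVisible_letter hΩ hfin c (a i)) _, ?_⟩
  ext k
  simp only [mem_ofPred_eq, mem_iInter₂, BiInfinite.visits, BiInfinite.cylinder,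
    BiInfinite.shift_apply, Finset.mem_coe]
  refine forall₂_congr fun i hi => ?_
  have : k + j + ((i - j).toNat : ℤ) = i + k := by have := hj i hi; omega
  rw [this]

theorem mul_le_sub (h : IsEnumeration C Ω p q) {δ : ℝ}
    (hδ : ∀ g ∈ consecutiveGaps (C.modelSet Ω), δ ≤ g) (m : ℤ) (N : ℕ) :
    N * δ ≤ p (m + N) - p m := by
  induction N with
  | zero => simp
  | succ N ih =>
    have := hδ _ (sub_mem_consecutiveGaps h.strictMono h.range_eq (m + N))
    push_cast
    rw [← add_assoc]
    linarith

theorem sub_le_mul (h : IsEnumeration C Ω p q) {R : ℝ}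
    (hR : ∀ g ∈ consecutiveGaps (C.modelSet Ω), g ≤ R) (m : ℤ) (N : ℕ) :
    p (m + N) - p m ≤ N * R := by
  induction N with
  | zero => simp
  | succ N ih =>
    have := hR _ (sub_mem_consecutiveGaps h.strictMono h.range_eq (m + N))
    push_cast
    rw [← add_assoc]
    linarith

/-- A non-empty visible set has bounded gaps: since no `q k` lies on a boundary, the visible set is
already cut out by a non-empty open set. -/
theorem isSyndetic_of_isVisible (h : IsEnumeration C Ω p q) (hΩ : IsGenericRegular C Ω)
    (hfin : (consecutiveGaps (C.modelSet Ω)).Finite) {K : Set ℤ} (hK : IsVisible C q K)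
    (hne : K.Nonempty) : BiInfinite.IsSyndetic K := by
  obtain ⟨W, hW, hKW⟩ := hK
  obtain ⟨k₀, hk₀⟩ := hne
  have hVgen := hW.inter hΩ
  have hV : (interior (W ∩ Ω)).Nonempty := by
    refine ⟨q k₀, ?_⟩
    by_contra hcon
    exact hVgen.notMem_frontier _ (h.mem_lattice k₀)
      ⟨subset_closure ⟨(hKW k₀).1 hk₀, h.mem_window k₀⟩, hcon⟩
  obtain ⟨R, hR, hit⟩ := C.exists_lattice_mem_strip isOpen_interior hV
  obtain ⟨δ, hδpos, hδ⟩ : ∃ δ > 0, ∀ g ∈ consecutiveGaps (C.modelSet Ω), δ ≤ g := by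
    obtain ⟨g, hg, hmin⟩ := exists_min_image _ id hfin
      ⟨_, sub_mem_consecutiveGaps h.strictMono h.range_eq 0⟩
    exact ⟨g, pos_of_mem_consecutiveGaps hg, hmin⟩
  obtain ⟨M, hM⟩ := exists_nat_gt (2 * R / δ)
  rw [div_lt_iff₀ hδpos] at hM
  refine ⟨M, fun m => ?_⟩
  obtain ⟨l, hl, h1, h2⟩ := hit (p m + R, 0)
  rw [sub_zero] at h2
  have h3 := interior_subset h2
  obtain ⟨k, rfl⟩ := h.exists_of_mem_lattice hl h3.2
  rw [abs_le] at h1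
  have hmk : m ≤ k := h.strictMono.le_iff_le.1 (by linarith [h1.1])
  have hkM : k < m + M := h.strictMono.lt_iff_lt.1 (by linarith [h1.2, h.mul_le_sub hδ m M])
  refine ⟨(k - m).toNat, by omega, ?_⟩
  rw [Int.toNat_of_nonneg (by omega), add_sub_cancel, hKW]
  exact h3.1

/-- Counting indices in an interval amounts to counting lattice points in a box. -/
theorem visitCount_eq_latticeCount (h : IsEnumeration C Ω p q) {K : Set ℤ}
    {W : Set (EuclideanSpace ℝ (Fin n))} (hKW : ∀ k, k ∈ K ↔ q k ∈ W) (m : ℤ) (N : ℕ) :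
    BiInfinite.visitCount K m N =
      C.latticeCount (box (p m, 0) (p (m + N) - p m) (W ∩ Ω)) := by
  classical
  have hset : (C.lattice : Set (ℝ × EuclideanSpace ℝ (Fin n))) ∩
      box (p m, 0) (p (m + N) - p m) (W ∩ Ω) =
      (fun i : ℕ => (p (m + i), q (m + i))) ''
        ((Finset.range N).filter fun i : ℕ => m + (i : ℤ) ∈ K : Finset ℕ) := by
    ext l
    simp only [box, mem_inter_iff, mem_ofPred_eq, sub_zero, add_sub_cancel, mem_image,
      Finset.mem_coe, Finset.mem_filter, Finset.mem_range]
    constructor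
    · rintro ⟨hl, h1, h2, hW, hΩ⟩
      obtain ⟨k, rfl⟩ := h.exists_of_mem_lattice hl hΩ
      have h1' := h.strictMono.le_iff_le.1 h1
      have h2' := h.strictMono.lt_iff_lt.1 h2
      have hk : m + ((k - m).toNat : ℤ) = k := by omega
      exact ⟨(k - m).toNat, ⟨by omega, by rw [hk, hKW]; exact hW⟩, by rw [hk]⟩
    · rintro ⟨i, ⟨hi, hK⟩, rfl⟩
      exact ⟨h.mem_lattice _, h.strictMono.monotone (by omega), h.strictMono (by omega),
        (hKW _).1 hK, h.mem_window _⟩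
  have hinj : Function.Injective fun i : ℕ => (p (m + i), q (m + i)) := by
    intro i j hij
    have := h.strictMono.injective (congrArg Prod.fst hij)
    omega
  rw [latticeCount, hset, ncard_image_of_injective _ hinj, ncard_coe_finset,
    BiInfinite.visitCount, Finset.card_filter]
  push_cast
  refine Finset.sum_congr rfl fun i _ => ?_
  rw [indicator_apply]

/-- Visible sets have uniform frequencies: both the elements of `K` and all indices in an interval
are counted by lattice points in a strip, so the frequency is the ratio of the two densities. -/
theorem exists_hasUniformFrequency (h : IsEnumeration C Ω p q) (hΩ : IsGenericRegular C Ω)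
    (hwin : IsWindow Ω) (hfin : (consecutiveGaps (C.modelSet Ω)).Finite) {K : Set ℤ}
    (hK : IsVisible C q K) : ∃ f, BiInfinite.HasUniformFrequency K f := by
  obtain ⟨κ, hκ, hdens⟩ := C.exists_uniform_density
  obtain ⟨W, hW, hKW⟩ := hK
  have hbdd : Bornology.IsBounded Ω := hwin.isCompact.isBounded
  obtain ⟨R, hR⟩ := hfin.bddAbove
  have hRpos : 0 < R :=
    have hg := sub_mem_consecutiveGaps h.strictMono h.range_eq 0
    (pos_of_mem_consecutiveGaps hg).trans_le (hR hg)
  have hvol : 0 < volume.real Ω := ENNReal.toReal_pos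
    ((isOpen_interior.measure_pos volume hwin.interior_nonempty).trans_le
      (measure_mono interior_subset)).ne' hbdd.measure_lt_top.ne
  have hdΩ : 0 < κ * volume.real Ω := mul_pos hκ hvol
  obtain ⟨dW, hdW⟩ : ∃ d, d = κ * volume.real (W ∩ Ω) := ⟨_, rfl⟩
  obtain ⟨dΩ, hdΩ'⟩ : ∃ d, d = κ * volume.real Ω := ⟨_, rfl⟩
  have hdWnn : 0 ≤ dW := hdW ▸ mul_nonneg hκ.le measureReal_nonneg
  rw [← hdΩ'] at hdΩ
  obtain ⟨f, hf⟩ : ∃ f, f = dW / dΩ := ⟨_, rfl⟩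
  have hfnn : 0 ≤ f := hf ▸ div_nonneg hdWnn hdΩ.le
  have hfd : f * dΩ = dW := by rw [hf]; field_simp
  refine ⟨f, fun ε hε => ?_⟩
  -- Errors are proportional to physical length, and `N` consecutive gaps have length at most
  -- `N * R`; the count of `K` enters with factor `1`, that of all indices with factor `f`.
  obtain ⟨ε', hε'⟩ : ∃ e, e = ε / (R * (1 + f)) := ⟨_, rfl⟩
  have hε'pos : 0 < ε' := by rw [hε']; positivity
  obtain ⟨c₁, hc₁⟩ := hdens (W ∩ Ω) (hbdd.subset inter_subset_right) (hW.inter hΩ).1 ε' hε'pos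
  obtain ⟨c₂, hc₂⟩ := hdens Ω hbdd hΩ.1 ε' hε'pos
  refine ⟨c₁ + f * c₂, fun m N => ?_⟩
  obtain ⟨T, hT⟩ : ∃ T, T = p (m + N) - p m := ⟨_, rfl⟩
  have hT0 : 0 ≤ T := hT ▸ sub_nonneg.2 (h.strictMono.monotone (by omega))
  have hTR : T ≤ N * R := hT ▸ h.sub_le_mul (fun g hg => hR hg) m N
  have h1 := hc₁ T hT0 (p m, 0)
  have h2 := hc₂ T hT0 (p m, 0)
  have hN : (N : ℝ) = C.latticeCount (box (p m, 0) T Ω) := by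
    have := h.visitCount_eq_latticeCount (K := univ) (W := univ) (fun _ => Iff.rfl) m N
    rw [univ_inter, ← hT] at this
    simpa [BiInfinite.visitCount] using this
  rw [hT, ← h.visitCount_eq_latticeCount hKW, ← hT, ← hdW] at h1
  rw [← hN, ← hdΩ'] at h2
  calc |BiInfinite.visitCount K m N - f * N|
      = |(BiInfinite.visitCount K m N - dW * T) - f * (N - dΩ * T)| := by
        rw [← hfd]; congr 1; ring
    _ ≤ |BiInfinite.visitCount K m N - dW * T| + |f * (N - dΩ * T)| := abs_sub _ _
    _ ≤ (ε' * T + c₁) + f * (ε' * T + c₂) := by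
        rw [abs_mul, abs_of_nonneg hfnn]
        gcongr
    _ = ε' * (1 + f) * T + (c₁ + f * c₂) := by ring
    _ ≤ ε' * (1 + f) * (N * R) + (c₁ + f * c₂) := by gcongr
    _ = ε * N + (c₁ + f * c₂) := by rw [hε']; field_simp

end IsEnumeration

end CutProjectScheme

/-! ### The coding sequence -/

theorem mainTheorem4 {n : ℕ} (C : CutProjectScheme n)
    (Ω : Set (EuclideanSpace ℝ (Fin n)))
    (hΩ : CutProjectScheme.IsWindow Ω)
    (hreg : CutProjectScheme.IsRegularWindow Ω)
    (hgen : C.IsGenericWindow Ω) :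
    (∃ p : ℤ → ℝ, StrictMono p ∧ Set.range p = C.modelSet Ω) ∧
    (consecutiveGaps (C.modelSet Ω)).Finite ∧
    ∀ p : ℤ → ℝ, StrictMono p → Set.range p = C.modelSet Ω →
      ∀ (A : Type*) [Finite A] [TopologicalSpace A] [DiscreteTopology A]
        [MeasurableSpace A] [DiscreteMeasurableSpace A] (c : ℝ → A),
        Set.InjOn c (consecutiveGaps (C.modelSet Ω)) →
        BiInfinite.IsStrictlyErgodic (fun k : ℤ => c (p (k + 1) - p k)) ∧
        BiInfinite.LIClass (fun k : ℤ => c (p (k + 1) - p k)) =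
          BiInfinite.orbitClosure (fun k : ℤ => c (p (k + 1) - p k)) := by
  have hfin := CutProjectScheme.finite_consecutiveGaps (C := C) hΩ
  refine ⟨CutProjectScheme.exists_enumeration hΩ, hfin, ?_⟩
  intro p hp hr A _ _ _ _ _ c _
  have hstar : ∀ k, ∃ y, (p k, y) ∈ C.lattice := fun k =>
    let ⟨y, _, hy⟩ := CutProjectScheme.exists_of_mem_modelSet
      (show p k ∈ C.modelSet Ω from hr ▸ Set.mem_range_self k)
    ⟨y, hy⟩
  choose q hq using hstar
  have h : C.IsEnumeration Ω p q := ⟨hp, hr, hq⟩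
  have hG : C.IsGenericRegular Ω := .of_window hreg hgen
  have hsynd : ∀ I : Finset ℤ, BiInfinite.IsSyndetic (BiInfinite.visits
      (fun k : ℤ => c (p (k + 1) - p k))
      (BiInfinite.cylinder I fun k : ℤ => c (p (k + 1) - p k))) := by
    intro I
    obtain ⟨K, j, hK, hvis⟩ := h.exists_isVisible_visits hG hfin c I
      (fun k : ℤ => c (p (k + 1) - p k))
    have h0 : (0 : ℤ) ∈ BiInfinite.visits (fun k : ℤ => c (p (k + 1) - p k))
        (BiInfinite.cylinder I fun k : ℤ => c (p (k + 1) - p k)) := fun i _ => by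
      simp [BiInfinite.shift_apply]
    rw [hvis] at h0 ⊢
    exact (h.isSyndetic_of_isVisible hG hfin hK ⟨_, h0⟩).translate j
  have hfreq : ∀ I a, ∃ f, BiInfinite.HasUniformFrequency (BiInfinite.visits
      (fun k : ℤ => c (p (k + 1) - p k)) (BiInfinite.cylinder I a)) f := by
    intro I a
    obtain ⟨K, j, hK, hvis⟩ := h.exists_isVisible_visits hG hfin c I a
    obtain ⟨f, hf⟩ := h.exists_hasUniformFrequency hG hΩ hfin hK
    exact ⟨f, hvis ▸ hf.translate j⟩
  exact ⟨⟨BiInfinite.isMinimal_orbitClosure hsynd, BiInfinite.isUniquelyErgodic_orbitClosure hfreq⟩,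
    BiInfinite.liClass_eq_orbitClosure hsynd⟩
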